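/- Let $N\ge 1$, $[N]=\{1,\dots,N\}$, and let $R:[N]^2\to[N]^2$ be a solution of the Yang-Baxter equation, that is, a bijection satisfying $$R_{12}R_{23}R_{12}=R_{23}R_{12}R_{23}\quad\text{on }[N]^3,$$ where $R_{12}$ (resp. $R_{23}$) is $R$ acting on the first two (resp. last two) coordinates and the identity on the remaining one. For $k\ge 2$ let $\mathbb F^+_{R,k}$ be the single-vertex $k$-graph associated to $R$: the unital semigroup generated by $e^i_{s}$ ($1\le i\le k$, $s\in[N]$) subject to the relations $e^i_s e^j_t=e^j_{t'}e^i_{s'}$ whenever $1\le i<j\le k$ and $R(s,t)=(t',s')$, together with the degree homomorphism $d:\mathbb F^+_{R,k}\to\mathbb N^k$, $d(e^i_s)=\epsilon_i$. An infinite path $x$ in it is a family of elements $x(m,n)\in\mathbb F^+_{R,k}$, for $m\le n$ in $\mathbb N^k$, with $d(x(m,n))=n-m$, $x(m,m)=1$ and $x(l,m)\,x(m,n)=x(l,n)$ for $l\le m\le n$; its shift by $p\in\mathbb N^k$ is $\sigma^p(x)(m,n)=x(m+p,n+p)$. The $k$-graph is called periodic if there are $m\ne n$ in $\mathbb N^k$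 such that $\sigma^m(x)=\sigma^n(x)$ for every infinite path $x$. Then, for every $k\ge 3$, the $2$-graph $\mathbb F^+_{R,2}$ is periodic if and only if the $k$-graph $\mathbb F^+_{R,k}$ is periodic. -/

import Mathlib

/-- The map `R` acting on the first two coordinates of `X³`, identity on the third. -/
def leg12 {X : Type*} (R : X × X → X × X) (p : X × X × X) : X × X × X :=
  ((R (p.1, p.2.1)).1, (R (p.1, p.2.1)).2, p.2.2)

/-- The map `R` acting on the last two coordinates of `X³`, identity on the first. -/
def leg23 {X : Type*} (R : X × X → X × X) (p : X × X × X) : X × X × X :=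
  (p.1, R p.2)

/-- `R` is a set-theoretical solution of the Yang-Baxter equation (braided form) on `X`. -/
def IsYBESolution {X : Type*} (R : X × X → X × X) : Prop :=
  Function.Bijective R ∧
    leg12 R ∘ leg23 R ∘ leg12 R = leg23 R ∘ leg12 R ∘ leg23 R

/-- The commutation relations between the generators `e^i_s` (written `(i, s)`), `i` in `k` colours:
`e^i_s e^j_t = e^j_{t'} e^i_{s'}` for `i < j` and `R (s, t) = (t', s')`. -/
inductive ColourRel {N : ℕ} (R : Fin N × Fin N → Fin N × Fin N) (k : ℕ) :
    FreeMonoid (Fin k × Fin N) → FreeMonoid (Fin k × Fin N) → Prop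
  | swap (i j : Fin k) (hij : i < j) (s t : Fin N) :
      ColourRel R k
        (FreeMonoid.of (i, s) * FreeMonoid.of (j, t))
        (FreeMonoid.of (j, (R (s, t)).1) * FreeMonoid.of (i, (R (s, t)).2))

/-- The unital semigroup `F_R⁺` of rank `k`, given by generators and relations: the morphisms
of the single-vertex `k`-graph associated to `R`. -/
abbrev AssocGraph {N : ℕ} (R : Fin N × Fin N → Fin N × Fin N) (k : ℕ) : Type :=
  PresentedMonoid (ColourRel R k)

/-- The degree map of `F_R⁺`: the monoid homomorphism to `ℕ^k` with `e^i_s ↦ ε_i`. -/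
def assocDegree {N : ℕ} (R : Fin N × Fin N → Fin N × Fin N) (k : ℕ) :
    AssocGraph R k →* Multiplicative (Fin k → ℕ) :=
  PresentedMonoid.lift
    (fun g : Fin k × Fin N => Multiplicative.ofAdd (Pi.single g.1 1 : Fin k → ℕ))
    (by
      rintro _ _ ⟨i, j, _, s, t⟩
      simp [mul_comm])

/-- An infinite path in a single-vertex `k`-graph, i.e. in a monoid `Λ` with degree map `d`:
a degree-preserving functor from the category `Ω_k = {(m, n) : m ≤ n in ℕ^k}` to `Λ`. -/
@[ext]
structure InfinitePath {k : ℕ} {Λ : Type*} [Monoid Λ] (d : Λ →* Multiplicative (Fin k → ℕ)) where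
  /-- The segment `x(m, n)` of the path. -/
  seg : ∀ m n : Fin k → ℕ, m ≤ n → Λ
  degree_seg : ∀ (m n : Fin k → ℕ) (h : m ≤ n), Multiplicative.toAdd (d (seg m n h)) = n - m
  seg_self : ∀ m : Fin k → ℕ, seg m m le_rfl = 1
  seg_mul : ∀ (l m n : Fin k → ℕ) (h₁ : l ≤ m) (h₂ : m ≤ n),
    seg l m h₁ * seg m n h₂ = seg l n (h₁.trans h₂)

/-- The shift `σ^p` on infinite paths: `σ^p(x)(m, n) = x(m + p, n + p)`. -/
def InfinitePath.shift {k : ℕ} {Λ : Type*} [Monoid Λ] {d : Λ →* Multiplicative (Fin k → ℕ)}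
    (p : Fin k → ℕ) (x : InfinitePath d) : InfinitePath d where
  seg m n h := x.seg (m + p) (n + p) (add_le_add_left h p)
  degree_seg m n h := by
    rw [x.degree_seg]
    exact add_tsub_add_eq_tsub_right n p m
  seg_self m := x.seg_self (m + p)
  seg_mul l m n h₁ h₂ := x.seg_mul (l + p) (m + p) (n + p) _ _

/-- A single-vertex `k`-graph is periodic if two distinct shifts agree on all infinite paths. -/
def IsPeriodicGraph {k : ℕ} {Λ : Type*} [Monoid Λ] (d : Λ →* Multiplicative (Fin k → ℕ)) : Prop :=
  ∃ m n : Fin k → ℕ, m ≠ n ∧ ∀ x : InfinitePath d, x.shift m = x.shift n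

/-! An infinite path is a labelling of the edges of the grid `ℕ^k` whose two-coloured squares all
obey `R` (`isPeriodicGraph_iff`); the Yang-Baxter equation makes the squares on a cube fit together
(`IsBraided.cube`). So a labelling of a coordinate face extends to the grid
(`IsLabelling.exists_extension`), and any labels can be prepended to a labelling
(`IsLabelling.exists_prepend_labels`).

The eventual periods of the `a`-coloured edges, common to all labellings, form a group
`colourPeriods R a`; periodicity means that some nonzero vector lies in all these groups. Only the
order of the colours matters: under a strictly increasing `f`, `p` is a period for `j` iff its
push-forward is one for `f j`. With at least two labels, counting shows that a common period has
coordinate sum zero.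

From 2 to `k`: a common period is `(h, -h)`, so `h(ε_c - ε_a)` is a period for `a`, for every `c`;
differences give `h(ε_0 - ε_1)` for every `a`.

From `k` to 2: embed the `k` colours into `3k + 2` colours. Two embeddings differing only at `q`
have push-forwards whose difference moves the entry `p q`. All entries but that of one colour `s`
can thus be collected at one place `v`, and the zero sum leaves `p_s(ε_a - ε_v)`. Taking for `s` the
first and the last colour of the support, `r` and `t`, gives `p_r(ε_c - ε_d)` for `c` and `p_t(ε_d -
ε_c)` for `d`. Hence `p_t p_r(ε_c - ε_d)` serves both, and it descends to two colours. -/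

/-! ### Braided permutations and the cube condition -/

section Labelling

variable {C X : Type*} [LinearOrder C]

/-- The permutation of `X × X` that exchanges an edge of colour `i` followed by one of colour `j`. -/
def colourSwap (R : Equiv.Perm (X × X)) (i j : C) : Equiv.Perm (X × X) :=
  if i < j then R else R⁻¹

theorem colourSwap_inv (R : Equiv.Perm (X × X)) {i j : C} (h : i ≠ j) :
    (colourSwap R i j)⁻¹ = colourSwap R j i := by
  unfold colourSwap
  rcases lt_or_gt_of_ne h with h | h <;> simp [h, h.not_gt]

theorem colourSwap_symm {R : Equiv.Perm (X × X)} {i j : C} (h : i ≠ j) {p q : X × X}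
    (hpq : colourSwap R i j p = q) : colourSwap R j i q = p := by
  rw [← colourSwap_inv R h, ← hpq, Equiv.Perm.inv_def, Equiv.symm_apply_apply]

/-- `leg12` for permutations. -/
def permLeg12 (e : Equiv.Perm (X × X)) : Equiv.Perm (X × X × X) where
  toFun := leg12 e
  invFun := leg12 e.symm
  left_inv p := by simp [leg12]
  right_inv p := by simp [leg12]

/-- `leg23` for permutations. -/
def permLeg23 (e : Equiv.Perm (X × X)) : Equiv.Perm (X × X × X) where
  toFun := leg23 e
  invFun := leg23 e.symm
  left_inv p := by simp [leg23]
  right_inv p := by simp [leg23]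

theorem permLeg12_inv (e : Equiv.Perm (X × X)) : permLeg12 e⁻¹ = (permLeg12 e)⁻¹ := rfl

theorem permLeg23_inv (e : Equiv.Perm (X × X)) : permLeg23 e⁻¹ = (permLeg23 e)⁻¹ := rfl

/-- The braid relation for the two legs of a permutation of `X × X`. -/
def IsBraided (R : Equiv.Perm (X × X)) : Prop :=
  permLeg12 R * permLeg23 R * permLeg12 R = permLeg23 R * permLeg12 R * permLeg23 R

/-- For each order of the three colours this is the braid relation or one of its rearrangements `e1`
to `e5`; the two remaining cases contradict transitivity. -/
theorem IsBraided.colourSwap_braid {R : Equiv.Perm (X × X)} (hR : IsBraided R) {i j l : C}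
    (hij : i ≠ j) (hil : i ≠ l) (hjl : j ≠ l) :
    permLeg12 (colourSwap R j l) * permLeg23 (colourSwap R i l) * permLeg12 (colourSwap R i j) =
      permLeg23 (colourSwap R i j) * permLeg12 (colourSwap R i l) *
        permLeg23 (colourSwap R j l) := by
  unfold IsBraided at hR
  generalize ha : permLeg12 R = a at hR
  generalize hb : permLeg23 R = b at hR
  have e1 : a⁻¹ * b * a = b * a * b⁻¹ := by
    rw [eq_mul_inv_iff_mul_eq, mul_assoc, mul_assoc, inv_mul_eq_iff_eq_mul, ← mul_assoc, ← hR,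
      mul_assoc]
  have e2 : a * b * a⁻¹ = b⁻¹ * a * b := by
    rw [mul_inv_eq_iff_eq_mul, mul_assoc, mul_assoc, eq_inv_mul_iff_mul_eq, ← mul_assoc, ← hR,
      mul_assoc]
  have e3 : a⁻¹ * b⁻¹ * a⁻¹ = b⁻¹ * a⁻¹ * b⁻¹ := by
    have := congrArg (·⁻¹) hR
    simpa [mul_assoc] using this
  have e4 : a⁻¹ * b⁻¹ * a = b * a⁻¹ * b⁻¹ := by
    have := congrArg (·⁻¹) e1
    simpa [mul_assoc] using this
  have e5 : a * b⁻¹ * a⁻¹ = b⁻¹ * a⁻¹ * b := by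
    have := congrArg (·⁻¹) e2
    simpa [mul_assoc] using this
  unfold colourSwap
  rcases lt_or_gt_of_ne hij with h1 | h1 <;> rcases lt_or_gt_of_ne hil with h2 | h2 <;>
    rcases lt_or_gt_of_ne hjl with h3 | h3
  · simp only [h1, h2, h3, if_true, ha, hb, hR]
  · simp only [h1, h2, h3.not_gt, if_true, if_false, permLeg12_inv, permLeg23_inv, ha, hb, e1]
  · exact absurd (h1.trans h3) h2.not_gt
  · simp only [h1, h2.not_gt, h3.not_gt, if_true, if_false, permLeg12_inv, permLeg23_inv, ha, hb,
      e4]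
  · simp only [h1.not_gt, h2, h3, if_true, if_false, permLeg12_inv, permLeg23_inv, ha, hb, e2]
  · exact absurd (h2.trans h3) h1.not_gt
  · simp only [h1.not_gt, h2.not_gt, h3, if_true, if_false, permLeg12_inv, permLeg23_inv, ha, hb,
      e5]
  · simp only [h1.not_gt, h2.not_gt, h3.not_gt, if_false, permLeg12_inv, permLeg23_inv, ha, hb,
      e3]

/-- The braid relation read on the six squares of a cube: the two ways across end in the same
labels, so five squares force the sixth. -/
theorem IsBraided.cube {R : Equiv.Perm (X × X)} (hR : IsBraided R) {i j l : C}
    (hij : i ≠ j) (hil : i ≠ l) (hjl : j ≠ l) {x₁ x₂ x₃ y₁ y₂ y₃ z₁ z₂ z₃ u₂ u₃ v₁ v₃ : X}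
    (h₁ : colourSwap R i j (x₁, x₂) = (y₂, y₁)) (h₂ : colourSwap R i l (y₁, x₃) = (y₃, z₁))
    (h₃ : colourSwap R j l (y₂, y₃) = (z₃, z₂)) (k₁ : colourSwap R j l (x₂, x₃) = (u₃, u₂))
    (k₂ : colourSwap R i l (x₁, u₃) = (v₃, v₁)) :
    v₃ = z₃ ∧ colourSwap R i j (v₁, u₂) = (z₂, z₁) := by
  have h := congrArg (fun e => e (x₁, x₂, x₃)) (hR.colourSwap_braid hij hil hjl)
  simp only [Equiv.Perm.mul_apply, permLeg12, permLeg23, Equiv.coe_fn_mk, leg12, leg23, h₁, h₂, h₃,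
    k₁, k₂, Prod.mk.injEq] at h
  exact ⟨h.1.symm, by rw [← Prod.mk.eta (p := colourSwap R i j (v₁, u₂)), ← h.2]⟩

/-! ### Labellings and routes in the grid -/

/-- A labelling by `X` of the edges of the grid `ℕ^C` such that all squares with sides in colours
from `S` are compatible with `R`. The edge of colour `i` at `n` goes from `n` to `n + ε_i`. -/
def IsLabelling (R : Equiv.Perm (X × X)) (S : Set C) (E : C → (C → ℕ) → X) : Prop :=
  ∀ i ∈ S, ∀ j ∈ S, i ≠ j → ∀ n : C → ℕ,
    colourSwap R i j (E i n, E j (n + Pi.single i 1)) = (E j n, E i (n + Pi.single j 1))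

theorem isLabelling_of_lt {R : Equiv.Perm (X × X)} {S : Set C} {E : C → (C → ℕ) → X}
    (h : ∀ i ∈ S, ∀ j ∈ S, i < j → ∀ n : C → ℕ,
      R (E i n, E j (n + Pi.single i 1)) = (E j n, E i (n + Pi.single j 1))) :
    IsLabelling R S E := by
  have key : ∀ i ∈ S, ∀ j ∈ S, i < j → ∀ n : C → ℕ,
      colourSwap R i j (E i n, E j (n + Pi.single i 1)) = (E j n, E i (n + Pi.single j 1)) := by
    intro i hi j hj hij n
    rw [colourSwap, if_pos hij, h i hi j hj hij n]
  intro i hi j hj hij n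
  rcases lt_or_gt_of_ne hij with hlt | hlt
  · exact key i hi j hj hlt n
  · exact colourSwap_symm hlt.ne (key j hj i hi hlt n)

theorem IsLabelling.shift {R : Equiv.Perm (X × X)} {S : Set C} {E : C → (C → ℕ) → X}
    (hE : IsLabelling R S E) (b : C → ℕ) : IsLabelling R S (fun i n => E i (b + n)) := by
  intro i hi j hj hij n
  simpa only [add_assoc] using hE i hi j hj hij (b + n)

/-- The number of steps of each colour in a route. -/
def displacement (w : List C) : C → ℕ := fun i => w.count i

@[simp] theorem displacement_nil : displacement ([] : List C) = 0 := rfl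

@[simp] theorem displacement_cons (i : C) (w : List C) :
    displacement (i :: w) = Pi.single i 1 + displacement w := by
  ext j
  by_cases h : j = i
  · subst h; simp [displacement, add_comm]
  · simp [displacement, Pi.single_eq_of_ne h, List.count_cons_of_ne (Ne.symm h)]

@[simp] theorem displacement_append (v w : List C) :
    displacement (v ++ w) = displacement v + displacement w := by
  ext j; simp [displacement]

theorem perm_of_displacement_eq {v w : List C} (h : displacement v = displacement w) :
    v.Perm w :=
  List.perm_iff_count.2 fun i => congrFun h i

/-- A route with prescribed displacement. -/
noncomputable def route [Fintype C] (m : C → ℕ) : List C :=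
  (∑ i, m i • ({i} : Multiset C)).toList

@[simp] theorem displacement_route [Fintype C] (m : C → ℕ) : displacement (route m) = m := by
  ext j
  rw [displacement, ← Multiset.coe_count, route, Multiset.coe_toList, Multiset.count_sum']
  simp [Multiset.count_nsmul, Multiset.count_singleton]

/-! ### Extending a labelling to further colours -/

/-- The label of the edge of colour `ω` at `n`, when the one after the route `w` is labelled `s`. -/
def pullBack (R : Equiv.Perm (X × X)) (ω : C) (E : C → (C → ℕ) → X) (s : X) :
    List C → (C → ℕ) → X
  | [], _ => s
  | j :: w, n => (colourSwap R j ω (E j n, pullBack R ω E s w (n + Pi.single j 1))).1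

/-- Exchanging two consecutive steps changes nothing, by the cube at that corner. -/
theorem pullBack_perm {R : Equiv.Perm (X × X)} (hR : IsBraided R) {S : Set C} {ω : C} (hω : ω ∉ S)
    {E : C → (C → ℕ) → X} (hE : IsLabelling R S E) (s : X) {v w : List C} (hvw : v.Perm w) :
    (∀ i ∈ v, i ∈ S) → ∀ n, pullBack R ω E s v n = pullBack R ω E s w n := by
  induction hvw with
  | nil => intros; rfl
  | cons i _ ih =>
    intro h n
    simp only [pullBack]
    rw [ih fun j hj => h j (List.mem_cons_of_mem _ hj)]
  | swap i j w =>
    intro h n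
    have hi : i ∈ S := h i (by simp)
    have hj : j ∈ S := h j (by simp)
    by_cases hij : j = i
    · rw [hij]
    have hjω : j ≠ ω := fun e => hω (e ▸ hj)
    have hiω : i ≠ ω := fun e => hω (e ▸ hi)
    simp only [pullBack, add_right_comm n (Pi.single i 1) (Pi.single j 1)]
    exact (hR.cube hij hjω hiω (hE j hj i hi hij n) rfl rfl rfl rfl).1
  | trans h₁ _ ih₁ ih₂ =>
    intro h n
    rw [ih₁ h, ih₂ fun i hi => h i (h₁.mem_iff.2 hi)]

/-- Compactness: put `s` where all `S`-coordinates equal `M`, pull back, and let `M` grow along a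
nonprincipal ultrafilter; the limit exists since `X` is finite. By the cube, the opposite sides of
the squares again form a labelling. -/
theorem IsLabelling.exists_parallel [Fintype C] [Finite X] [Nonempty X] {R : Equiv.Perm (X × X)}
    (hR : IsBraided R) {S : Set C} {ω : C} (hω : ω ∉ S) {E : C → (C → ℕ) → X}
    (hE : IsLabelling R S E) :
    ∃ (F : (C → ℕ) → X) (E' : C → (C → ℕ) → X), IsLabelling R S E' ∧
      ∀ j ∈ S, ∀ n, colourSwap R j ω (E j n, F (n + Pi.single j 1)) = (F n, E' j n) := by
  classical
  obtain ⟨s⟩ := ‹Nonempty X›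
  let gap : ℕ → (C → ℕ) → C → ℕ := fun M n j => if j ∈ S then M - n j else 0
  let approx : ℕ → (C → ℕ) → X := fun M n => pullBack R ω E s (route (gap M n)) n
  have happrox : ∀ j ∈ S, ∀ n : C → ℕ, ∀ M, n j < M →
      approx M n = (colourSwap R j ω (E j n, approx M (n + Pi.single j 1))).1 := by
    intro j hj n M hM
    change pullBack R ω E s (route (gap M n)) n =
      pullBack R ω E s (j :: route (gap M (n + Pi.single j 1))) n
    refine pullBack_perm hR hω hE s (perm_of_displacement_eq ?_) ?_ n
    · ext i
      by_cases hij : i = j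
      · subst hij
        simp [gap, hj]
        omega
      · simp [gap, Pi.single_eq_of_ne hij]
    · intro i hi
      by_contra hiS
      have : displacement (route (gap M n)) i = 0 := by simp [gap, hiS]
      exact (List.count_pos_iff.2 hi).ne' this
  have hlim : ∀ n, ∃ a, ∀ᶠ M in (Filter.hyperfilter ℕ : Filter ℕ), approx M n = a := by
    intro n
    obtain ⟨a, ha⟩ := Ultrafilter.eq_pure_of_finite ((Filter.hyperfilter ℕ).map fun M => approx M n)
    refine ⟨a, ?_⟩
    have : {a} ∈ (Filter.hyperfilter ℕ).map fun M => approx M n := by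
      rw [ha]; exact Set.mem_singleton a
    exact this
  choose F hF using hlim
  have hFstep : ∀ j ∈ S, ∀ n, F n = (colourSwap R j ω (E j n, F (n + Pi.single j 1))).1 := by
    intro j hj n
    have hlarge : ∀ᶠ M in (Filter.hyperfilter ℕ : Filter ℕ), n j < M := by
      refine Filter.Eventually.filter_mono ?_ (Filter.eventually_gt_atTop (n j))
      rw [← Nat.cofinite_eq_atTop]
      exact Filter.hyperfilter_le_cofinite
    -- A single `M` beyond `n j` realises both limits.
    obtain ⟨M, h₁, h₂, h₃⟩ := ((hF n).and ((hF (n + Pi.single j 1)).and hlarge)).exists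
    rw [← h₁, ← h₂]
    exact happrox j hj n M h₃
  refine ⟨F, fun j n => (colourSwap R j ω (E j n, F (n + Pi.single j 1))).2, ?_, ?_⟩
  · intro i hi j hj hij n
    have hiω : i ≠ ω := fun e => hω (e ▸ hi)
    have hjω : j ≠ ω := fun e => hω (e ▸ hj)
    have step : ∀ a ∈ S, ∀ m, colourSwap R a ω (E a m, F (m + Pi.single a 1)) =
        (F m, (colourSwap R a ω (E a m, F (m + Pi.single a 1))).2) := by
      intro a ha m
      exact Prod.ext (hFstep a ha m).symm rfl
    have k₁ := step j hj (n + Pi.single i 1)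
    rw [add_right_comm n (Pi.single i 1) (Pi.single j 1)] at k₁
    dsimp only
    rw [add_right_comm n (Pi.single i 1) (Pi.single j 1)]
    exact (hR.cube hij hiω hjω (hE i hi j hj hij n) (step i hi (n + Pi.single j 1)) (step j hj n)
      k₁ (step i hi n)).2
  · intro j hj n
    exact Prod.ext (hFstep j hj n).symm rfl

/-- Layers from `exists_parallel` are stacked: each takes the labelling at height `t` in direction
`ω` to one at height `t + 1`. -/
theorem IsLabelling.exists_insert [Fintype C] [Finite X] [Nonempty X] {R : Equiv.Perm (X × X)}
    (hR : IsBraided R) {S : Set C} {ω : C} (hω : ω ∉ S) {E : C → (C → ℕ) → X}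
    (hE : IsLabelling R S E) :
    ∃ E', IsLabelling R (insert ω S) E' ∧ ∀ j ∈ S, ∀ n, n ω = 0 → E' j n = E j n := by
  classical
  have hstep : ∀ L : {E : C → (C → ℕ) → X // IsLabelling R S E}, ∃ (F : (C → ℕ) → X)
      (L' : {E : C → (C → ℕ) → X // IsLabelling R S E}), ∀ j ∈ S, ∀ n,
      colourSwap R j ω (L.1 j n, F (n + Pi.single j 1)) = (F n, L'.1 j n) := by
    rintro ⟨E, hE⟩
    obtain ⟨F, E', hE', h⟩ := hE.exists_parallel hR hω
    exact ⟨F, ⟨E', hE'⟩, h⟩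
  choose F next hnext using hstep
  let level : ℕ → {E : C → (C → ℕ) → X // IsLabelling R S E} :=
    fun t => Nat.rec ⟨E, hE⟩ (fun _ L => next L) t
  let base : (C → ℕ) → C → ℕ := fun n => Function.update n ω 0
  have hbase : ∀ n j, j ≠ ω → base (n + Pi.single j 1) = base n + Pi.single j 1 := by
    intro n j hj
    ext i
    by_cases hi : i = ω
    · subst hi; simp [base, hj]
    · simp [base, hi]
  have hbaseω : ∀ n, base (n + Pi.single ω 1) = base n := by
    intro n
    ext i
    by_cases hi : i = ω
    · subst hi; simp [base]
    · simp [base, hi]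
  let E' : C → (C → ℕ) → X := fun i n =>
    if i = ω then F (level (n ω)) (base n) else (level (n ω)).1 i (base n)
  have hω' : ∀ n, E' ω n = F (level (n ω)) (base n) := fun n => if_pos rfl
  have hne' : ∀ i, i ≠ ω → ∀ n, E' i n = (level (n ω)).1 i (base n) := fun i hi n => if_neg hi
  have hmix : ∀ j ∈ S, ∀ n, colourSwap R j ω (E' j n, E' ω (n + Pi.single j 1)) =
      (E' ω n, E' j (n + Pi.single ω 1)) := by
    intro j hj n
    have hjω : j ≠ ω := fun e => hω (e ▸ hj)
    rw [hω', hω', hne' j hjω, hne' j hjω, hbaseω, hbase n j hjω]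
    have e1 : (n + Pi.single j 1 : C → ℕ) ω = n ω := by simp [hjω]
    have e2 : (n + Pi.single ω 1 : C → ℕ) ω = n ω + 1 := by simp
    rw [e1, e2]
    exact hnext (level (n ω)) j hj (base n)
  refine ⟨E', ?_, ?_⟩
  · rintro i hi j hj hij n
    by_cases hiω : i = ω
    · subst hiω
      have hj' : j ∈ S := hj.resolve_left (Ne.symm hij)
      exact colourSwap_symm (Ne.symm hij) (hmix j hj' n)
    · have hi' : i ∈ S := hi.resolve_left hiω
      by_cases hjω : j = ω
      · subst hjω
        exact hmix i hi' n
      · have hj' : j ∈ S := hj.resolve_left hjω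
        rw [hne' i hiω, hne' j hjω, hne' i hiω, hne' j hjω, hbase n i hiω, hbase n j hjω]
        have e1 : (n + Pi.single i 1 : C → ℕ) ω = n ω := by simp [hiω]
        have e2 : (n + Pi.single j 1 : C → ℕ) ω = n ω := by simp [hjω]
        rw [e1, e2]
        exact (level (n ω)).2 i hi' j hj' hij (base n)
  · intro j hj n hn
    have hjω : j ≠ ω := fun e => hω (e ▸ hj)
    have hb : base n = n := by
      ext i
      by_cases hi : i = ω
      · subst hi; simp [base, hn]
      · simp [base, hi]
    rw [hne' j hjω, hn, hb]
    rfl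

theorem IsLabelling.exists_extension [Fintype C] [Finite X] [Nonempty X] {R : Equiv.Perm (X × X)}
    (hR : IsBraided R) {S : Set C} {E : C → (C → ℕ) → X} (hE : IsLabelling R S E) :
    ∃ E', IsLabelling R Set.univ E' ∧
      ∀ j ∈ S, ∀ n : C → ℕ, (∀ i ∉ S, n i = 0) → E' j n = E j n := by
  classical
  have key : ∀ T : Finset C, ∃ E', IsLabelling R (S ∪ T) E' ∧
      ∀ j ∈ S, ∀ n : C → ℕ, (∀ i ∉ S, n i = 0) → E' j n = E j n := by
    intro T
    induction T using Finset.induction_on with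
    | empty => exact ⟨E, by simpa using hE, fun _ _ _ _ => rfl⟩
    | insert ω T hωT ih =>
      obtain ⟨E₁, h₁, h₁'⟩ := ih
      by_cases hω : ω ∈ S
      · refine ⟨E₁, ?_, h₁'⟩
        rwa [Finset.coe_insert, Set.union_insert, Set.insert_eq_of_mem (Set.mem_union_left _ hω)]
      · obtain ⟨E₂, h₂, h₂'⟩ := h₁.exists_insert hR (ω := ω) (by simp [hω, hωT])
        refine ⟨E₂, ?_, fun j hj n hn => ?_⟩
        · rwa [Finset.coe_insert, Set.union_insert]
        · rw [h₂' j (Or.inl hj) n (hn ω hω), h₁' j hj n hn]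
  obtain ⟨E', h, h'⟩ := key Finset.univ
  exact ⟨E', by simpa using h, h'⟩

/-! ### Prepending edges to a labelling -/

/-- The label of the edge of colour `i` at the end of the route `w` from `n`, when the one at `n` is
labelled `s` and `E` labels the parallel copy of the route one step further in direction `i`. -/
def pushForward (R : Equiv.Perm (X × X)) (i : C) (E : C → (C → ℕ) → X) :
    List C → (C → ℕ) → X → X
  | [], _, s => s
  | j :: w, n, s => pushForward R i E w (n + Pi.single j 1) (colourSwap R i j (s, E j n)).2

theorem pushForward_append (R : Equiv.Perm (X × X)) (i : C) (E : C → (C → ℕ) → X) (v w : List C)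
    (n : C → ℕ) (s : X) :
    pushForward R i E (v ++ w) n s =
      pushForward R i E w (n + displacement v) (pushForward R i E v n s) := by
  induction v generalizing n s with
  | nil => simp [pushForward]
  | cons j v ih => simp [pushForward, ih, add_assoc]

theorem pushForward_perm {R : Equiv.Perm (X × X)} (hR : IsBraided R) {i : C}
    {E : C → (C → ℕ) → X} (hE : IsLabelling R Set.univ E) {v w : List C} (hvw : v.Perm w) :
    i ∉ v → ∀ n s, pushForward R i E v n s = pushForward R i E w n s := by
  induction hvw with
  | nil => intros; rfl
  | cons j _ ih =>
    intro h n s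
    simp only [pushForward]
    rw [ih fun hj => h (List.mem_cons_of_mem _ hj)]
  | swap j l w =>
    intro h n s
    have hij : i ≠ j := fun e => h (by simp [e])
    have hil : i ≠ l := fun e => h (by simp [e])
    by_cases hjl : l = j
    · rw [hjl]
    simp only [pushForward, add_right_comm n (Pi.single j 1) (Pi.single l 1)]
    have h := (hR.cube hil hij hjl (x₁ := s) (x₂ := E l n) (x₃ := E j (n + Pi.single l 1))
      rfl rfl rfl (hE l trivial j trivial hjl n) rfl).2
    have h' := (congrArg Prod.snd h).symm
    exact congrArg (pushForward R i E w (n + Pi.single l 1 + Pi.single j 1)) h'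
  | trans h₁ _ ih₁ ih₂ =>
    intro h n s
    rw [ih₁ h, ih₂ fun hi => h (h₁.mem_iff.2 hi)]

/-- No limit is needed here: `s` at the origin propagates over the hyperplane `n i = 0`,
independently of the route by `pushForward_perm`. -/
theorem IsLabelling.exists_prepend [Fintype C] {R : Equiv.Perm (X × X)} (hR : IsBraided R)
    {E : C → (C → ℕ) → X} (hE : IsLabelling R Set.univ E) (i : C) (s : X) :
    ∃ E', IsLabelling R Set.univ E' ∧ E' i 0 = s ∧
      ∀ j (n : C → ℕ), E' j (Pi.single i 1 + n) = E j n := by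
  classical
  let base : (C → ℕ) → C → ℕ := fun n => Function.update n i 0
  have hbase : ∀ (n : C → ℕ) j, j ≠ i → base (n + Pi.single j 1) = base n + Pi.single j 1 := by
    intro n j hj
    ext a
    by_cases ha : a = i
    · subst ha; simp [base, hj]
    · simp [base, ha]
  have hbase₀ : ∀ n : C → ℕ, n i = 0 → base n = n := by
    intro n hn
    ext a
    by_cases ha : a = i
    · subst ha; simp [base, hn]
    · simp [base, ha]
  let G : (C → ℕ) → X := fun n => pushForward R i E (route (base n)) 0 s
  have hG : ∀ (n : C → ℕ) j, j ≠ i → n i = 0 →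
      G (n + Pi.single j 1) = (colourSwap R i j (G n, E j n)).2 := by
    intro n j hj hn
    have hperm : (route (base (n + Pi.single j 1))).Perm (route (base n) ++ [j]) :=
      perm_of_displacement_eq (by simp [hbase n j hj])
    have hi : i ∉ route (base (n + Pi.single j 1)) := by
      intro hi
      have h₀ : displacement (route (base (n + Pi.single j 1))) i = 0 := by
        rw [displacement_route]; simp [base]
      exact (List.count_pos_iff.2 hi).ne' h₀
    change pushForward R i E _ 0 s = _
    rw [pushForward_perm hR hE hperm hi, pushForward_append]
    simp only [pushForward, displacement_route, zero_add, hbase₀ n hn, G]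
  -- The old labelling starts at height 1 in direction `i`; the squares between the two heights fill
  -- the hyperplane below it.
  let E' : C → (C → ℕ) → X := fun j n =>
    if n i = 0 then (if j = i then G n else (colourSwap R i j (G n, E j n)).1)
    else E j (n - Pi.single i 1)
  have hi₀ : ∀ n : C → ℕ, n i = 0 → E' i n = G n := fun n hn => by simp [E', hn]
  have hj₀ : ∀ (n : C → ℕ) j, j ≠ i → n i = 0 → E' j n = (colourSwap R i j (G n, E j n)).1 :=
    fun n j hj hn => by simp [E', hn, hj]
  have hpos : ∀ j (n : C → ℕ), E' j (n + Pi.single i 1) = E j n := fun j n => by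
    simp [E']
  have hmix : ∀ (n : C → ℕ) j, j ≠ i → n i = 0 → colourSwap R i j (E' i n, E' j (n + Pi.single i 1))
      = (E' j n, E' i (n + Pi.single j 1)) := by
    intro n j hj hn
    rw [hi₀ n hn, hpos, hj₀ n j hj hn, hi₀ _ (by simp [hn, hj]), hG n j hj hn]
  refine ⟨E', ?_, ?_, ?_⟩
  · intro a _ b _ hab n
    by_cases hn : n i = 0
    · by_cases ha : a = i
      · subst ha
        exact hmix n b (Ne.symm hab) hn
      · by_cases hb : b = i
        · subst hb
          exact colourSwap_symm (Ne.symm hab) (hmix n a hab hn)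
        · rw [hj₀ n a ha hn, hj₀ n b hb hn, hj₀ _ b hb (by simp [hn, ha]),
            hj₀ _ a ha (by simp [hn, hb]), hG n a ha hn, hG n b hb hn]
          obtain ⟨h₁, h₂⟩ := hR.cube (Ne.symm hb) (Ne.symm ha) (Ne.symm hab) (x₁ := G n)
            (x₂ := E b n) (x₃ := E a (n + Pi.single b 1)) rfl rfl rfl
            (hE b trivial a trivial (Ne.symm hab) n) rfl
          refine colourSwap_symm (Ne.symm hab) (Prod.ext ?_ ?_)
          · exact h₁.symm
          · exact (congrArg Prod.fst h₂).symm
    · obtain ⟨m, rfl⟩ : ∃ m : C → ℕ, n = m + Pi.single i 1 := by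
        refine ⟨n - Pi.single i 1, (tsub_add_cancel_of_le ?_).symm⟩
        intro a
        by_cases ha : a = i
        · subst ha; simp; omega
        · simp [ha]
      rw [add_right_comm m (Pi.single i 1) (Pi.single a 1),
        add_right_comm m (Pi.single i 1) (Pi.single b 1), hpos, hpos, hpos, hpos]
      exact hE a trivial b trivial hab m
  · rw [hi₀ 0 rfl]
    have h₀ : base 0 = 0 := hbase₀ 0 rfl
    have hnil : route (0 : C → ℕ) = [] :=
      List.perm_nil.1 (perm_of_displacement_eq (by simp))
    simp only [G, h₀, hnil, pushForward]
  · intro j n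
    rw [add_comm, hpos]

/-- The labels of the edges met along the route `w` from `n`. -/
def labelsAlong (E : C → (C → ℕ) → X) : List C → (C → ℕ) → List X
  | [], _ => []
  | i :: w, n => E i n :: labelsAlong E w (n + Pi.single i 1)

theorem labelsAlong_length (E : C → (C → ℕ) → X) (w : List C) (n : C → ℕ) :
    (labelsAlong E w n).length = w.length := by
  induction w generalizing n with
  | nil => rfl
  | cons i w ih => simp [labelsAlong, ih]

theorem labelsAlong_append (E : C → (C → ℕ) → X) (v w : List C) (n : C → ℕ) :
    labelsAlong E (v ++ w) n = labelsAlong E v n ++ labelsAlong E w (n + displacement v) := by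
  induction v generalizing n with
  | nil => simp [labelsAlong]
  | cons i v ih => simp [labelsAlong, ih, add_assoc]

theorem labelsAlong_congr {E E' : C → (C → ℕ) → X} (w : List C) (b b' : C → ℕ)
    (h : ∀ i n, E i (b + n) = E' i (b' + n)) : labelsAlong E w b = labelsAlong E' w b' := by
  induction w generalizing b b' with
  | nil => rfl
  | cons i w ih =>
    have h₀ := h i 0
    simp only [add_zero] at h₀
    simp only [labelsAlong, h₀]
    rw [ih _ (b' + Pi.single i 1) fun j n => by simpa only [add_assoc] using h j (Pi.single i 1 + n)]

/-- Two consecutive sides of a square determine the other two. -/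
theorem labelsAlong_perm {R : Equiv.Perm (X × X)} {E E' : C → (C → ℕ) → X}
    (hE : IsLabelling R Set.univ E) (hE' : IsLabelling R Set.univ E') {v w : List C}
    (hvw : v.Perm w) : ∀ n, labelsAlong E v n = labelsAlong E' v n →
      labelsAlong E w n = labelsAlong E' w n := by
  induction hvw with
  | nil => intros; rfl
  | cons i _ ih =>
    intro n h
    simp only [labelsAlong, List.cons.injEq] at h ⊢
    exact ⟨h.1, ih _ h.2⟩
  | swap i j w =>
    intro n h
    by_cases hij : j = i
    · rwa [hij] at h ⊢
    simp only [labelsAlong, List.cons.injEq] at h ⊢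
    have h₁ := hE j trivial i trivial hij n
    have h₂ := hE' j trivial i trivial hij n
    rw [h.1, h.2.1, h₂, Prod.mk.injEq] at h₁
    rw [add_right_comm n (Pi.single i 1) (Pi.single j 1)]
    exact ⟨h₁.1.symm, h₁.2.symm, h.2.2⟩
  | trans _ _ ih₁ ih₂ => exact fun n h => ih₂ n (ih₁ n h)

theorem IsLabelling.exists_prepend_labels [Fintype C] {R : Equiv.Perm (X × X)} (hR : IsBraided R)
    {E : C → (C → ℕ) → X} (hE : IsLabelling R Set.univ E) (w : List C) (l : List X)
    (hl : l.length = w.length) :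
    ∃ E', IsLabelling R Set.univ E' ∧ labelsAlong E' w 0 = l ∧
      ∀ j n, E' j (displacement w + n) = E j n := by
  induction w generalizing l with
  | nil => exact ⟨E, hE, (List.length_eq_zero_iff.1 hl).symm, by simp⟩
  | cons i w ih =>
    obtain ⟨s, l, rfl⟩ := List.exists_cons_of_length_eq_add_one hl
    obtain ⟨E₁, h₁, h₂, h₃⟩ := ih l (by simpa using hl)
    obtain ⟨E₂, k₁, k₂, k₃⟩ := h₁.exists_prepend hR i s
    refine ⟨E₂, k₁, ?_, fun j n => ?_⟩
    · rw [labelsAlong, k₂, ← h₂]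
      congr 1
      exact labelsAlong_congr w _ _ fun j n => by rw [zero_add, zero_add, k₃]
    · rw [displacement_cons, add_assoc, k₃, h₃]

/-- Lets a property that holds only far out be applied to any labelling from the origin on. -/
theorem IsLabelling.exists_shift_eq [Fintype C] [Nonempty X] {R : Equiv.Perm (X × X)}
    (hR : IsBraided R) {E : C → (C → ℕ) → X} (hE : IsLabelling R Set.univ E) (p : C → ℕ) :
    ∃ E', IsLabelling R Set.univ E' ∧ ∀ j n, E' j (p + n) = E j n := by
  obtain ⟨s⟩ := ‹Nonempty X›
  obtain ⟨E', h, _, h'⟩ := hE.exists_prepend_labels hR (route p)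
    (List.replicate (route p).length s) (by simp)
  exact ⟨E', h, by simpa using h'⟩

/-! ### Counting: periods preserve total degree -/

/-- Some two distinct shifts agree on all labellings. -/
def HasPeriodicLabellings (R : Equiv.Perm (X × X)) (C : Type*) [LinearOrder C] : Prop :=
  ∃ m n : C → ℕ, m ≠ n ∧ ∀ E : C → (C → ℕ) → X, IsLabelling R Set.univ E →
    ∀ i l, E i (l + m) = E i (l + n)

theorem exists_labelling [Fintype C] [Finite X] [Nonempty X] {R : Equiv.Perm (X × X)}
    (hR : IsBraided R) : ∃ E : C → (C → ℕ) → X, IsLabelling R Set.univ E := by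
  obtain ⟨s⟩ := ‹Nonempty X›
  obtain ⟨E, hE, _⟩ := IsLabelling.exists_extension hR (S := (∅ : Set C)) (E := fun _ _ => s)
    (fun i hi => hi.elim)
  exact ⟨E, hE⟩

theorem length_route {C : Type*} [Fintype C] (m : C → ℕ) : (route m).length = ∑ i, m i := by
  simp [route]

/-- After a fixed word along `q = m + n`, the labels of the next `m`-segment are arbitrary but are
determined by those of the next `n`-segment, so `|X|^|m| ≤ |X|^|n|`. -/
theorem sum_le_sum_of_period [Fintype C] [Finite X] [Nontrivial X] {R : Equiv.Perm (X × X)}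
    (hR : IsBraided R) {m n : C → ℕ}
    (h : ∀ E : C → (C → ℕ) → X, IsLabelling R Set.univ E → ∀ i l, E i (l + m) = E i (l + n)) :
    ∑ i, m i ≤ ∑ i, n i := by
  classical
  obtain ⟨E₀, hE₀⟩ := exists_labelling (C := C) hR
  obtain ⟨s⟩ : Nonempty X := inferInstance
  let q : C → ℕ := m + n
  have hex : ∀ l : List.Vector X (route m).length, ∃ E, IsLabelling R Set.univ E ∧
      labelsAlong E (route q ++ route m) 0 = List.replicate (route q).length s ++ l.1 := by
    intro l
    obtain ⟨E, hE, hl, _⟩ := hE₀.exists_prepend_labels hR (route q ++ route m)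
      (List.replicate (route q).length s ++ l.1) (by simp [l.2])
    exact ⟨E, hE, hl⟩
  choose E hE hEl using hex
  have hpart : ∀ l, labelsAlong (E l) (route q) 0 = List.replicate (route q).length s ∧
      labelsAlong (E l) (route m) q = l.1 := by
    intro l
    have := hEl l
    rw [labelsAlong_append, displacement_route, zero_add] at this
    exact List.append_inj this (by simp [labelsAlong_length])
  let f : List.Vector X (route m).length → List.Vector X (route n).length := fun l =>
    ⟨labelsAlong (E l) (route n) q, labelsAlong_length _ _ _⟩
  have hf : Function.Injective f := by
    intro l l' hll
    have h₁ : labelsAlong (E l) (route q ++ route n) 0 =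
        labelsAlong (E l') (route q ++ route n) 0 := by
      rw [labelsAlong_append, labelsAlong_append, (hpart l).1, (hpart l').1, displacement_route,
        zero_add]
      exact congrArg _ (congrArg Subtype.val hll)
    -- As `q + n = n + (n + m)`, the labels from `n` along `n`, then `m`, are known. The period
    -- moves this route to start at `m`; its last leg then starts at `q` and carries `l`.
    have h₂ := labelsAlong_perm (hE l) (hE l')
      (w := route n ++ (route n ++ route m)) (perm_of_displacement_eq (by
        simp only [displacement_append, displacement_route, q]; abel)) 0 h₁
    rw [labelsAlong_append, labelsAlong_append (E l'), displacement_route, zero_add] at h₂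
    have h₃ := (List.append_inj h₂ (by simp [labelsAlong_length])).2
    have hmn : ∀ l, labelsAlong (E l) (route n ++ route m) n =
        labelsAlong (E l) (route n ++ route m) m := by
      intro l
      refine labelsAlong_congr _ _ _ fun i a => ?_
      rw [add_comm n, add_comm m, h (E l) (hE l)]
    rw [hmn, hmn, labelsAlong_append, labelsAlong_append (E l'), displacement_route] at h₃
    have h₄ := (List.append_inj h₃ (by simp [labelsAlong_length])).2
    have e : m + n = q := rfl
    rw [e, (hpart l).2, (hpart l').2] at h₄
    exact Subtype.ext h₄
  cases nonempty_fintype X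
  have hcard := Fintype.card_le_of_injective f hf
  rw [card_vector, card_vector, length_route, length_route] at hcard
  exact (Nat.pow_le_pow_iff_right Fintype.one_lt_card).1 hcard

end Labelling

/-! ### Groups of eventual periods -/

section Periods

variable {C X : Type*} [LinearOrder C] {R : Equiv.Perm (X × X)}

/-- `p` is a period of the edges of colour `a` in all labellings, sufficiently far out. -/
def IsColourPeriod (R : Equiv.Perm (X × X)) (a : C) (p : C → ℤ) : Prop :=
  ∃ P : C → ℕ, ∀ E : C → (C → ℕ) → X, IsLabelling R Set.univ E →
    ∀ b b' : C → ℕ, P ≤ b → P ≤ b' → (∀ i, (b' i : ℤ) - b i = p i) → E a b = E a b'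

/-- The group of eventual periods of the edges of colour `a`. -/
def colourPeriods (R : Equiv.Perm (X × X)) (a : C) : AddSubgroup (C → ℤ) where
  carrier := {p | IsColourPeriod R a p}
  zero_mem' := ⟨0, fun E _ b b' _ _ h => by
    have : b = b' := funext fun i => by have := h i; simp at this; omega
    rw [this]⟩
  neg_mem' := by
    rintro p ⟨P, hP⟩
    refine ⟨P, fun E hE b b' hb hb' h => (hP E hE b' b hb' hb fun i => ?_).symm⟩
    have := h i
    simp at this
    omega
  add_mem' := by
    rintro p q ⟨P, hP⟩ ⟨Q, hQ⟩
    -- The term `|p i|` keeps the intermediate point `b + p` above both thresholds.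
    refine ⟨fun i => P i + Q i + (p i).natAbs, fun E hE b b' hb hb' h => ?_⟩
    have hb : ∀ i, P i + Q i + (p i).natAbs ≤ b i := hb
    have hb' : ∀ i, P i + Q i + (p i).natAbs ≤ b' i := hb'
    have hmid : ∀ i, (((b i : ℤ) + p i).toNat : ℤ) = b i + p i := fun i =>
      Int.toNat_of_nonneg (by have := hb i; omega)
    refine (hP E hE b (fun i => ((b i : ℤ) + p i).toNat) (fun i => ?_) (fun i => ?_)
      (fun i => ?_)).trans (hQ E hE _ b' (fun i => ?_) (fun i => ?_) (fun i => ?_))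
    all_goals
      beta_reduce
      have h₁ := hb i
      have h₂ := hb' i
      have h₃ := hmid i
      have h₄ : (b' i : ℤ) - b i = p i + q i := h i
      omega

theorem hasPeriodicLabellings_iff [Fintype C] :
    HasPeriodicLabellings R C ↔ ∃ p : C → ℤ, p ≠ 0 ∧ ∀ a, p ∈ colourPeriods R a := by
  constructor
  · rintro ⟨m, n, hmn, h⟩
    refine ⟨fun i => (n i : ℤ) - m i, fun h₀ => hmn (funext fun i => ?_), fun a => ⟨m, ?_⟩⟩
    · have := congrFun h₀ i
      simp at this
      omega
    · intro E hE b b' hb hb' hbb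
      have hb : ∀ i, m i ≤ b i := hb
      have h₁ := h E hE a (b - m)
      rw [tsub_add_cancel_of_le hb] at h₁
      rw [h₁]
      congr 1
      ext i
      have h₂ : (b' i : ℤ) - b i = n i - m i := hbb i
      have h₃ := hb i
      simp only [Pi.add_apply, Pi.sub_apply]
      omega
  · rintro ⟨p, hp, h⟩
    choose P hP using h
    -- A base point such that it and its translate by `p` lie above the thresholds of all colours.
    refine ⟨fun i => ∑ a, P a i + (p i).natAbs,
      fun i => ((∑ a, P a i : ℕ) + (p i).natAbs + p i : ℤ).toNat, fun h₀ => hp (funext fun i => ?_),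
      fun E hE a l => ?_⟩
    · have h₁ : ∑ a, P a i + (p i).natAbs =
        ((∑ a, P a i : ℕ) + (p i).natAbs + p i : ℤ).toNat := congrFun h₀ i
      change p i = 0
      omega
    · have hle : ∀ i, P a i ≤ ∑ a, P a i := fun i =>
        Finset.single_le_sum (f := fun a => P a i) (fun _ _ => Nat.zero_le _) (Finset.mem_univ a)
      refine hP a E hE _ _ (fun i => ?_) (fun i => ?_) fun i => ?_
      · have := hle i
        simp only [Pi.add_apply]
        omega
      · have := hle i
        simp only [Pi.add_apply]
        omega
      · simp only [Pi.add_apply]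
        omega

theorem sum_eq_zero_of_period [Fintype C] [Finite X] [Nontrivial X] (hR : IsBraided R)
    {p : C → ℤ} (hp : ∀ a, p ∈ colourPeriods R a) : ∑ i, p i = 0 := by
  choose P hP using hp
  let u : C → ℕ := fun i => ∑ a, P a i + (p i).natAbs
  let v : C → ℕ := fun i => ((∑ a, P a i : ℕ) + (p i).natAbs + p i : ℤ).toNat
  have hle : ∀ a i, P a i ≤ ∑ a, P a i := fun a i =>
    Finset.single_le_sum (f := fun a => P a i) (fun _ _ => Nat.zero_le _) (Finset.mem_univ a)
  have h : ∀ E : C → (C → ℕ) → X, IsLabelling R Set.univ E →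
      ∀ i l, E i (l + u) = E i (l + v) := by
    intro E hE a l
    refine hP a E hE _ _ (fun i => ?_) (fun i => ?_) fun i => ?_
    · have := hle a i
      simp only [Pi.add_apply, u]
      omega
    · have := hle a i
      simp only [Pi.add_apply, v]
      omega
    · simp only [Pi.add_apply, u, v]
      omega
  have h₁ := sum_le_sum_of_period hR h
  have h₂ := sum_le_sum_of_period hR fun E hE i l => (h E hE i l).symm
  have h₃ : (∑ i, (v i : ℤ)) - ∑ i, (u i : ℤ) = ∑ i, p i := by
    rw [← Finset.sum_sub_distrib]
    refine Finset.sum_congr rfl fun i _ => ?_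
    simp only [u, v]
    omega
  zify at h₁ h₂
  omega

end Periods

/-! ### Periods under order embeddings of colours -/

section Embedding

variable {C J X : Type*} [LinearOrder C] {R : Equiv.Perm (X × X)}

/-- The push-forward of an integer vector along a map of index sets. -/
def pushVector [Fintype J] (f : J → C) (p : J → ℤ) : C → ℤ := ∑ i, Pi.single (f i) (p i)

theorem pushVector_apply [Fintype J] {f : J → C} (hf : Function.Injective f) (p : J → ℤ) (j : J) :
    pushVector f p (f j) = p j := by
  rw [pushVector, Finset.sum_apply, Finset.sum_eq_single j]
  · simp
  · intro i _ hi
    exact Pi.single_eq_of_ne (fun h => hi (hf h).symm) _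
  · simp

theorem pushVector_apply_of_notMem [Fintype J] {f : J → C} (p : J → ℤ) {c : C} (hc : ∀ j, f j ≠ c) :
    pushVector f p c = 0 := by
  rw [pushVector, Finset.sum_apply]
  exact Finset.sum_eq_zero fun i _ => Pi.single_eq_of_ne (hc i).symm _

theorem colourSwap_comp [LinearOrder J] {f : J → C} (hf : StrictMono f) (i j : J) :
    colourSwap R (f i) (f j) = colourSwap R i j := by
  simp only [colourSwap, hf.lt_iff_lt]

variable [LinearOrder J] [Fintype J]

/-- Freezing the coordinates outside the image of `f` restricts a labelling to the colours `J`; the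
pushed vector vanishes there, so `b` and `b'` share a slice. -/
theorem pushVector_mem_colourPeriods {f : J → C} (hf : StrictMono f) {p : J → ℤ} {j : J}
    (hp : p ∈ colourPeriods R j) : pushVector f p ∈ colourPeriods R (f j) := by
  classical
  obtain ⟨P, hP⟩ := hp
  refine ⟨fun c => ∑ i, if f i = c then P i else 0, fun E hE b b' hb hb' h => ?_⟩
  have hinj := hf.injective
  have hval : ∀ i, (∑ i', if f i' = f i then P i' else 0) = P i := by
    intro i
    simp [hinj.eq_iff]
  let place : (J → ℕ) → C → ℕ := fun n => Function.extend f n b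
  have hplace : ∀ n i, place n (f i) = n i := fun n i => hinj.extend_apply n b i
  have hplace' : ∀ n c, (∀ i, f i ≠ c) → place n c = b c := fun n c hc =>
    Function.extend_apply' _ _ _ fun ⟨i, hi⟩ => hc i hi
  have hadd : ∀ n i, place (n + Pi.single i 1) = place n + Pi.single (f i) 1 := by
    intro n i
    ext c
    by_cases hc : ∃ a, f a = c
    · obtain ⟨a, rfl⟩ := hc
      rw [hplace, Pi.add_apply, Pi.add_apply, hplace]
      by_cases ha : a = i
      · subst ha; simp
      · rw [Pi.single_eq_of_ne ha, Pi.single_eq_of_ne (hinj.ne ha)]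
    · push Not at hc
      rw [hplace' _ c hc, Pi.add_apply, hplace' _ c hc, Pi.single_eq_of_ne (hc i).symm, add_zero]
  have hE' : IsLabelling R Set.univ fun i n => E (f i) (place n) := by
    intro i _ j _ hij n
    dsimp only
    rw [hadd, hadd, ← colourSwap_comp hf]
    exact hE (f i) trivial (f j) trivial (hinj.ne hij) (place n)
  have key := hP _ hE' (b ∘ f) (b' ∘ f)
    (fun i => (hval i).symm.le.trans (hb (f i))) (fun i => (hval i).symm.le.trans (hb' (f i)))
    (fun i => (h (f i)).trans (pushVector_apply hinj p i))
  have e₁ : place (b ∘ f) = b := by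
    ext c
    by_cases hc : ∃ a, f a = c
    · obtain ⟨a, rfl⟩ := hc
      exact hplace _ a
    · push Not at hc
      exact hplace' _ c hc
  have e₂ : place (b' ∘ f) = b' := by
    ext c
    by_cases hc : ∃ a, f a = c
    · obtain ⟨a, rfl⟩ := hc
      exact hplace _ a
    · push Not at hc
      rw [hplace' _ c hc]
      have := h c
      rw [pushVector_apply_of_notMem p hc] at this
      omega
  rwa [e₁, e₂] at key

/-- A labelling on `J` is carried to the range of `f`, extended to all colours and moved beyond the
threshold `P`; hence the period even holds from the origin on. -/
theorem mem_colourPeriods_of_pushVector [Fintype C] [Finite X] [Nonempty X] (hR : IsBraided R)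
    {f : J → C} (hf : StrictMono f) {p : J → ℤ} {j : J}
    (hp : pushVector f p ∈ colourPeriods R (f j)) : p ∈ colourPeriods R j := by
  classical
  obtain ⟨P, hP⟩ := hp
  have hinj := hf.injective
  refine ⟨0, fun e he b b' _ _ h => ?_⟩
  obtain ⟨s⟩ := ‹Nonempty X›
  let E₀ : C → (C → ℕ) → X := fun c n => if hc : ∃ i, f i = c then e hc.choose (n ∘ f) else s
  have hE₀ : ∀ i n, E₀ (f i) n = e i (n ∘ f) := by
    intro i n
    have hex : ∃ i', f i' = f i := ⟨i, rfl⟩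
    simp only [E₀, dif_pos hex, hinj hex.choose_spec]
  have hcomp : ∀ (n : C → ℕ) i, (n + Pi.single (f i) 1) ∘ f = n ∘ f + Pi.single i 1 := by
    intro n i
    ext a
    by_cases ha : a = i
    · subst ha; simp
    · simp [ha, hinj.ne ha]
  have hlab : IsLabelling R (Set.range f) E₀ := by
    rintro _ ⟨i, rfl⟩ _ ⟨i', rfl⟩ hii n
    rw [hE₀, hE₀, hE₀, hE₀, hcomp, hcomp, colourSwap_comp hf]
    exact he i trivial i' trivial (fun h => hii (congrArg f h)) _
  obtain ⟨E₁, h₁, h₁'⟩ := hlab.exists_extension hR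
  obtain ⟨E₂, h₂, h₂'⟩ := h₁.exists_shift_eq hR P
  let place : (J → ℕ) → C → ℕ := fun n => Function.extend f n 0
  have hplace : ∀ n i, place n (f i) = n i := fun n i => hinj.extend_apply n 0 i
  have hplace' : ∀ n c, (∀ i, f i ≠ c) → place n c = 0 := fun n c hc =>
    Function.extend_apply' _ _ _ fun ⟨i, hi⟩ => hc i hi
  have hval : ∀ n, E₂ (f j) (P + place n) = e j n := by
    intro n
    rw [h₂', h₁' (f j) ⟨j, rfl⟩, hE₀]
    · congr 1
      ext i
      exact hplace n i
    · intro c hc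
      exact hplace' n c fun i hi => hc ⟨i, hi⟩
  rw [← hval, ← hval]
  refine hP E₂ h₂ _ _ le_self_add le_self_add fun c => ?_
  simp only [Pi.add_apply]
  by_cases hc : ∃ a, f a = c
  · obtain ⟨a, rfl⟩ := hc
    rw [hplace, hplace, pushVector_apply hinj, ← h a]
    omega
  · push Not at hc
    rw [hplace' _ c hc, hplace' _ c hc, pushVector_apply_of_notMem p hc]
    omega

/-- If every other position of the period `p` can be moved to the colour `v`, only a multiple of
`ε_a - ε_v` remains. -/
theorem single_sub_single_mem_colourPeriods {p : J → ℤ} {s : J} (hp : p ∈ colourPeriods R s)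
    (hsum : ∑ i, p i = 0) {g : J → C} (hg : StrictMono g) {a v : C} (hga : g s = a)
    (hmove : ∀ q, q ≠ s → p q ≠ 0 → ∃ f : J → C, StrictMono f ∧ f s = a ∧ f q = g q ∧
      StrictMono (Function.update f q v)) :
    Pi.single a (p s) - Pi.single v (p s) ∈ colourPeriods R a := by
  classical
  -- The push-forwards along `f` and `Function.update f q v` differ only in the place of the entry
  -- `p q`.
  have hpart : ∀ q ∈ Finset.univ.erase s,
      Pi.single (g q) (p q) - Pi.single v (p q) ∈ colourPeriods R a := by
    intro q hq
    have hqs : q ≠ s := Finset.ne_of_mem_erase hq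
    by_cases hpq : p q = 0
    · rw [hpq, Pi.single_zero, Pi.single_zero, sub_zero]
      exact zero_mem _
    · obtain ⟨f, hf, hfs, hfq, hf'⟩ := hmove q hqs hpq
      have h₁ := pushVector_mem_colourPeriods hf hp
      have h₂ := pushVector_mem_colourPeriods hf' hp
      rw [Function.update_of_ne hqs.symm] at h₂
      rw [hfs] at h₁ h₂
      have h₃ := sub_mem h₁ h₂
      convert h₃ using 1
      rw [pushVector, pushVector, ← Finset.sum_sub_distrib, Finset.sum_eq_single q]
      · rw [hfq, Function.update_self]
      · intro i _ hi
        rw [Function.update_of_ne hi, sub_self]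
      · simp
  have h₀ := pushVector_mem_colourPeriods hg hp
  rw [hga] at h₀
  have h := sub_mem h₀ (sum_mem hpart)
  convert h using 1
  -- By `hsum`, the entries collected at `v` add up to `-p s`.
  have hv : (Pi.single v (p s) : C → ℤ) = - ∑ q ∈ Finset.univ.erase s, Pi.single v (p q) := by
    have h₁ : ∑ q, (Pi.single v (p q) : C → ℤ) = 0 := by
      have := map_sum (AddMonoidHom.single (fun _ : C => ℤ) v) p Finset.univ
      rw [hsum, map_zero] at this
      exact this.symm
    rw [← Finset.add_sum_erase _ _ (Finset.mem_univ s)] at h₁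
    exact eq_neg_of_add_eq_zero_left h₁
  rw [pushVector, ← Finset.add_sum_erase _ _ (Finset.mem_univ s), hga, Finset.sum_sub_distrib, hv]
  abel

end Embedding

/-! ### Comparison of two colours with `k` colours -/

section Main

variable {X : Type*} {R : Equiv.Perm (X × X)}

theorem hasPeriodicLabellings_of_two [Finite X] [Nontrivial X] (hR : IsBraided R) {k : ℕ}
    (hk : 2 ≤ k) (h : HasPeriodicLabellings R (Fin 2)) : HasPeriodicLabellings R (Fin k) := by
  rw [hasPeriodicLabellings_iff] at h ⊢
  obtain ⟨p, hp₀, hp⟩ := h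
  have hsum := sum_eq_zero_of_period hR hp
  rw [Fin.sum_univ_two] at hsum
  have hh : p 0 ≠ 0 := by
    intro h₀
    refine hp₀ (funext fun i => ?_)
    fin_cases i
    · exact h₀
    · simp; omega
  have hlt : ∀ c d : Fin k, c < d → ∀ a, a = c ∨ a = d →
      Pi.single c (p 0) - Pi.single d (p 0) ∈ colourPeriods R a := by
    intro c d hcd a ha
    have hf : StrictMono ![c, d] := by
      intro i j hij
      fin_cases i <;> fin_cases j <;> simp_all
    have hv : (Pi.single c (p 0) - Pi.single d (p 0) : Fin k → ℤ) = pushVector ![c, d] p := by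
      rw [pushVector, Fin.sum_univ_two, eq_neg_of_add_eq_zero_right hsum]
      simp [sub_eq_add_neg, Pi.single_neg]
    rw [hv]
    rcases ha with rfl | rfl
    · exact pushVector_mem_colourPeriods hf (hp 0)
    · exact pushVector_mem_colourPeriods hf (hp 1)
  have hne : ∀ c a : Fin k, Pi.single c (p 0) - Pi.single a (p 0) ∈ colourPeriods R a := by
    intro c a
    rcases lt_trichotomy c a with hca | rfl | hca
    · exact hlt c a hca a (Or.inr rfl)
    · rw [sub_self]
      exact zero_mem _
    · rw [← neg_sub]
      exact neg_mem (hlt a c hca a (Or.inl rfl))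
  refine ⟨Pi.single ⟨0, by omega⟩ (p 0) - Pi.single ⟨1, by omega⟩ (p 0), ?_, fun a => ?_⟩
  · intro h₀
    have := congrFun h₀ ⟨0, by omega⟩
    simp [hh] at this
  -- The difference is routed through the colour `a` itself.
  · rw [← sub_sub_sub_cancel_right _ _ (Pi.single a (p 0))]
    exact sub_mem (hne _ a) (hne _ a)

theorem hasPeriodicLabellings_two_of [Finite X] [Nontrivial X] (hR : IsBraided R) {k : ℕ}
    (h : HasPeriodicLabellings R (Fin k)) : HasPeriodicLabellings R (Fin 2) := by
  classical
  rw [hasPeriodicLabellings_iff] at h ⊢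
  obtain ⟨p, hp₀, hp⟩ := h
  have hsum := sum_eq_zero_of_period hR hp
  have hsupp : (Finset.univ.filter fun i => p i ≠ 0).Nonempty := by
    obtain ⟨i, hi⟩ := Function.ne_iff.1 hp₀
    exact ⟨i, by simpa using hi⟩
  obtain ⟨r, hr, hrmin⟩ := Finset.exists_min_image _ id hsupp
  obtain ⟨t, ht, htmax⟩ := Finset.exists_max_image _ id hsupp
  simp only [Finset.mem_filter, Finset.mem_univ, true_and, id] at hr hrmin ht htmax
  -- `c` and `d` separate three blocks of `k` places each: room for all colours before, between and
  -- after them.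
  let c : Fin (3 * k + 2) := ⟨k, by omega⟩
  let d : Fin (3 * k + 2) := ⟨2 * k + 1, by omega⟩
  have hc : (Pi.single c (p r) - Pi.single d (p r) : Fin (3 * k + 2) → ℤ) ∈ colourPeriods R c := by
    let g : Fin k → Fin (3 * k + 2) := fun i =>
      ⟨if i < r then i else if i = r then k else k + 1 + i, by split_ifs <;> omega⟩
    refine single_sub_single_mem_colourPeriods (hp r) hsum (g := g) ?_ (by simp [g, c]) ?_
    · intro i j hij
      simp only [g, Fin.lt_def, Fin.ext_iff] at hij ⊢
      split_ifs <;> omega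
    · intro q hqr hq
      have hrq := lt_of_le_of_ne (hrmin q hq) hqr.symm
      -- Colours after `q` go beyond `d`, which frees the way for `q` from the middle block to `d`;
      -- minimality of `r` puts `q` after `r`.
      refine ⟨fun i => if i ≤ q then g i else ⟨2 * k + 2 + i, by omega⟩, ?_, ?_, ?_, ?_⟩
      · intro i j hij
        simp only [g, Fin.lt_def, Fin.le_def, Fin.ext_iff,
          apply_ite Fin.val] at hij hrq ⊢
        split_ifs <;> omega
      · simp [hrq.le, g, c]
      · simp
      · intro i j hij
        simp only [Function.update_apply, g, d, Fin.lt_def, Fin.le_def, Fin.ext_iff,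
          apply_ite Fin.val] at hij hrq ⊢
        split_ifs <;> omega
  have hd : (Pi.single d (p t) - Pi.single c (p t) : Fin (3 * k + 2) → ℤ) ∈ colourPeriods R d := by
    let g : Fin k → Fin (3 * k + 2) := fun i =>
      ⟨if i < t then k + 1 + i else if i = t then 2 * k + 1 else 2 * k + 2 + i, by
        split_ifs <;> omega⟩
    refine single_sub_single_mem_colourPeriods (hp t) hsum (g := g) ?_ (by simp [g, d]) ?_
    · intro i j hij
      simp only [g, Fin.lt_def, Fin.ext_iff] at hij ⊢
      split_ifs <;> omega
    · intro q hqt hq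
      have hqt := lt_of_le_of_ne (htmax q hq) hqt
      -- Mirror image: colours before `q` go below `c`, so `q` can move down to `c`.
      refine ⟨fun i => if q ≤ i then g i else ⟨i, by omega⟩, ?_, ?_, ?_, ?_⟩
      · intro i j hij
        simp only [g, Fin.lt_def, Fin.le_def, Fin.ext_iff,
          apply_ite Fin.val] at hij hqt ⊢
        split_ifs <;> omega
      · simp [hqt.le, g, d]
      · simp
      · intro i j hij
        simp only [Function.update_apply, g, c, Fin.lt_def, Fin.le_def, Fin.ext_iff,
          apply_ite Fin.val] at hij hqt ⊢
        split_ifs <;> omega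
  have hf : StrictMono ![c, d] := by
    intro i j hij
    fin_cases i <;> fin_cases j <;> simp_all [c, d]; omega
  have hmul : ∀ (z w : ℤ) (a b : Fin (3 * k + 2)),
      z • (Pi.single a w - Pi.single b w : Fin (3 * k + 2) → ℤ) =
        Pi.single a (z * w) - Pi.single b (z * w) := by
    intro z w a b
    rw [smul_sub, ← Pi.single_smul', ← Pi.single_smul', smul_eq_mul]
  have hpush : pushVector ![c, d] ![p t * p r, -(p t * p r)] =
      Pi.single c (p t * p r) - Pi.single d (p t * p r) := by
    rw [pushVector, Fin.sum_univ_two]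
    simp [sub_eq_add_neg, Pi.single_neg]
  refine ⟨![p t * p r, -(p t * p r)], fun h₀ => ?_, fun a =>
    mem_colourPeriods_of_pushVector hR hf ?_⟩
  · have := congrFun h₀ 0
    simp [hr, ht] at this
  · rw [hpush]
    fin_cases a
    · rw [← hmul]
      exact zsmul_mem hc _
    · change _ ∈ colourPeriods R d
      rw [mul_comm (p t), ← neg_sub, ← hmul]
      exact neg_mem (zsmul_mem hd _)

theorem hasPeriodicLabellings_iff_two [Finite X] [Nonempty X] (hR : IsBraided R) {k : ℕ}
    (hk : 2 ≤ k) : HasPeriodicLabellings R (Fin 2) ↔ HasPeriodicLabellings R (Fin k) := by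
  rcases subsingleton_or_nontrivial X with hX | hX
  -- With a single label all shifts agree; the counting argument needs two labels.
  · have htriv : ∀ l, 2 ≤ l → HasPeriodicLabellings R (Fin l) := fun l hl =>
      ⟨0, fun _ => 1, fun h => absurd (congrFun h ⟨0, by omega⟩) (by simp),
        fun E _ i l => Subsingleton.elim _ _⟩
    exact iff_of_true (htriv 2 le_rfl) (htriv k hk)
  · exact ⟨hasPeriodicLabellings_of_two hR hk, hasPeriodicLabellings_two_of hR⟩

end Main

/-! ### Infinite paths as labellings -/

section Paths

variable {N k : ℕ} {R : Fin N × Fin N → Fin N × Fin N}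

/-- The generator of `F_R⁺` of colour `i` with label `s`. -/
def generator (R : Fin N × Fin N → Fin N × Fin N) (i : Fin k) (s : Fin N) : AssocGraph R k :=
  PresentedMonoid.of (ColourRel R k) (i, s)

theorem assocDegree_generator (i : Fin k) (s : Fin N) :
    assocDegree R k (generator R i s) = Multiplicative.ofAdd (Pi.single i 1) := rfl

theorem generator_mul_generator (hR : Function.Bijective R) {i j : Fin k} (hij : i ≠ j)
    {s t s' t' : Fin N} (h : colourSwap (Equiv.ofBijective R hR) i j (s, t) = (t', s')) :
    generator R i s * generator R j t = generator R j t' * generator R i s' := by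
  have key : ∀ (i j : Fin k) (_ : i < j) (s t s' t' : Fin N),
      colourSwap (Equiv.ofBijective R hR) i j (s, t) = (t', s') →
      generator R i s * generator R j t = generator R j t' * generator R i s' := by
    intro i j hij s t s' t' h
    rw [colourSwap, if_pos hij, Equiv.ofBijective_apply] at h
    have hrel := PresentedMonoid.mk_eq_mk_of_rel (ColourRel.swap (R := R) i j hij s t)
    rw [h] at hrel
    exact hrel
  rcases lt_or_gt_of_ne hij with hlt | hlt
  · exact key i j hlt s t s' t' h
  · exact (key j i hlt t' s' t s (colourSwap_symm hij h)).symm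

/-- A pair of generators, rewritten such that the first colour is not greater than the second. -/
def sortPair (e : Equiv.Perm (Fin N × Fin N)) (a b : Fin k × Fin N) :
    (Fin k × Fin N) × (Fin k × Fin N) :=
  if b.1 < a.1 then ((b.1, (e.symm (a.2, b.2)).1), (a.1, (e.symm (a.2, b.2)).2)) else (a, b)

/-- The action of a generator on words of length at most two, up to the commutation relations;
longer words are sent to `none`. -/
def appendGenerator (e : Equiv.Perm (Fin N × Fin N)) (a : Fin k × Fin N) :
    Option (List (Fin k × Fin N)) → Option (List (Fin k × Fin N))
  | some [] => some [a]
  | some [b] => some [(sortPair e b a).1, (sortPair e b a).2]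
  | _ => none

/-- The right action of `F_R⁺` on words of length at most two. -/
noncomputable def shortWordAction (hR : Function.Bijective R) :
    AssocGraph R k →* (Function.End (Option (List (Fin k × Fin N))))ᵐᵒᵖ :=
  PresentedMonoid.lift (rels := ColourRel R k)
    (fun a => (MulOpposite.op (appendGenerator (Equiv.ofBijective R hR) a) :
      (Function.End (Option (List (Fin k × Fin N))))ᵐᵒᵖ))
    (by
      rintro _ _ ⟨i, j, hij, s, t⟩
      simp only [map_mul, FreeMonoid.lift_eval_of]
      refine congrArg MulOpposite.op (funext fun l => ?_)
      change appendGenerator _ _ (appendGenerator _ _ l) =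
        appendGenerator _ _ (appendGenerator _ _ l)
      have hs : (Equiv.ofBijective R hR).symm (R (s, t)) = (s, t) :=
        (Equiv.ofBijective R hR).symm_apply_apply (s, t)
      -- Only the empty word involves the relation: two further letters send every other word to
      -- `none`.
      match l with
      | none => rfl
      | some [] => simp [appendGenerator, sortPair, hij, hij.not_gt, hs]
      | some [_] => rfl
      | some (_ :: _ :: _) => rfl)

theorem generator_injective (hR : Function.Bijective R) (i : Fin k) :
    Function.Injective (generator R i) := by
  intro s t h
  have h₁ := congrArg (fun g => (shortWordAction hR g).unop (some [])) h
  have h₂ : (some [(i, s)] : Option (List (Fin k × Fin N))) = some [(i, t)] := h₁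
  simpa using h₂

/-- Acting on the empty word yields the colour-sorted normal form of a two-letter product, so no
relation in this degree goes beyond the defining ones. -/
theorem colourSwap_of_generator_mul (hR : Function.Bijective R) {i j : Fin k} (hij : i < j)
    {s t s' t' : Fin N}
    (h : generator R i s * generator R j t = generator R j t' * generator R i s') :
    R (s, t) = (t', s') := by
  have h₁ := congrArg (fun g => (shortWordAction hR g).unop (some [])) h
  have h₂ : some [(sortPair (Equiv.ofBijective R hR) (i, s) (j, t)).1,
      (sortPair (Equiv.ofBijective R hR) (i, s) (j, t)).2] =
      some [(sortPair (Equiv.ofBijective R hR) (j, t') (i, s')).1,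
      (sortPair (Equiv.ofBijective R hR) (j, t') (i, s')).2] := h₁
  simp only [sortPair, hij, hij.not_gt, if_true, if_false, Option.some.injEq, List.cons.injEq,
    Prod.mk.injEq, true_and, and_true] at h₂
  have h₃ : (s, t) = (Equiv.ofBijective R hR).symm (t', s') := Prod.ext h₂.1 h₂.2
  exact ((Equiv.eq_symm_apply _).1 h₃)

theorem sum_assocDegree_mk (w : FreeMonoid (Fin k × Fin N)) :
    ∑ i, Multiplicative.toAdd (assocDegree R k (PresentedMonoid.mk (ColourRel R k) w)) i =
      w.length := by
  induction w using FreeMonoid.inductionOn with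
  | one => simp
  | of a =>
    change ∑ i, (Pi.single a.1 1 : Fin k → ℕ) i = 1
    simp
  | mul v w hv hw =>
    rw [map_mul, map_mul, toAdd_mul, FreeMonoid.length_mul, ← hv, ← hw, ← Finset.sum_add_distrib]
    rfl

theorem exists_eq_generator {g : AssocGraph R k} {i : Fin k}
    (hg : Multiplicative.toAdd (assocDegree R k g) = Pi.single i 1) :
    ∃ s, g = generator R i s := by
  obtain ⟨w, rfl⟩ := PresentedMonoid.surjective_mk g
  have hw := sum_assocDegree_mk (R := R) w
  rw [hg] at hw
  obtain ⟨⟨j, s⟩, rfl⟩ := FreeMonoid.length_eq_one.1 (hw.symm.trans (by simp))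
  have hg' : (Pi.single j 1 : Fin k → ℕ) = Pi.single i 1 := hg
  have hij : j = i := by
    by_contra hne
    have := congrFun hg' j
    simp [hne] at this
  subst hij
  exact ⟨s, rfl⟩

/-- The product of the generators met along a route. -/
def routeProd (R : Fin N × Fin N → Fin N × Fin N) (E : Fin k → (Fin k → ℕ) → Fin N)
    (w : List (Fin k)) (n : Fin k → ℕ) : AssocGraph R k :=
  (List.zipWith (generator R) w (labelsAlong E w n)).prod

@[simp] theorem routeProd_nil (E : Fin k → (Fin k → ℕ) → Fin N) (n : Fin k → ℕ) :
    routeProd R E [] n = 1 := rfl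

@[simp] theorem routeProd_cons (E : Fin k → (Fin k → ℕ) → Fin N) (i : Fin k) (w : List (Fin k))
    (n : Fin k → ℕ) :
    routeProd R E (i :: w) n = generator R i (E i n) * routeProd R E w (n + Pi.single i 1) := by
  simp [routeProd, labelsAlong]

theorem routeProd_append (E : Fin k → (Fin k → ℕ) → Fin N) (v w : List (Fin k)) (n : Fin k → ℕ) :
    routeProd R E (v ++ w) n = routeProd R E v n * routeProd R E w (n + displacement v) := by
  induction v generalizing n with
  | nil => simp
  | cons i v ih => simp [ih, mul_assoc, add_assoc]

theorem assocDegree_routeProd (E : Fin k → (Fin k → ℕ) → Fin N) (w : List (Fin k))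
    (n : Fin k → ℕ) :
    Multiplicative.toAdd (assocDegree R k (routeProd R E w n)) = displacement w := by
  induction w generalizing n with
  | nil => simp
  | cons i w ih =>
    rw [routeProd_cons, map_mul, toAdd_mul, ih, assocDegree_generator, displacement_cons,
      toAdd_ofAdd]

theorem routeProd_perm {hR : Function.Bijective R} {E : Fin k → (Fin k → ℕ) → Fin N}
    (hE : IsLabelling (Equiv.ofBijective R hR) Set.univ E) {v w : List (Fin k)}
    (hvw : v.Perm w) : ∀ n, routeProd R E v n = routeProd R E w n := by
  induction hvw with
  | nil => intro; rfl
  | cons i _ ih => intro n; rw [routeProd_cons, routeProd_cons, ih]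
  | swap i j w =>
    intro n
    by_cases hij : j = i
    · rw [hij]
    simp only [routeProd_cons, ← mul_assoc]
    rw [generator_mul_generator hR hij (hE j trivial i trivial hij n),
      add_right_comm n (Pi.single i 1)]
  | trans _ _ ih₁ ih₂ => exact fun n => (ih₁ n).trans (ih₂ n)

/-- The infinite path traced by a labelling. -/
noncomputable def pathOfLabelling {hR : Function.Bijective R} {E : Fin k → (Fin k → ℕ) → Fin N}
    (hE : IsLabelling (Equiv.ofBijective R hR) Set.univ E) : InfinitePath (assocDegree R k) where
  seg m n _ := routeProd R E (route (n - m)) m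
  degree_seg m n _ := by rw [assocDegree_routeProd, displacement_route]
  seg_self m := by
    have : route (m - m) = [] := List.perm_nil.1 (perm_of_displacement_eq (by simp))
    rw [this, routeProd_nil]
  seg_mul l m n h₁ h₂ := by
    have hm : m = l + displacement (route (m - l)) := by
      rw [displacement_route, add_tsub_cancel_of_le h₁]
    conv_lhs => rw [show routeProd R E (route (n - m)) m =
      routeProd R E (route (n - m)) (l + displacement (route (m - l))) by rw [← hm]]
    rw [← routeProd_append]
    refine routeProd_perm hE (perm_of_displacement_eq ?_) l
    simp only [displacement_append, displacement_route]
    rw [add_comm, tsub_add_tsub_cancel h₂ h₁]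

theorem pathOfLabelling_seg_edge {hR : Function.Bijective R} {E : Fin k → (Fin k → ℕ) → Fin N}
    (hE : IsLabelling (Equiv.ofBijective R hR) Set.univ E) (i : Fin k) {m n : Fin k → ℕ}
    (hmn : n = m + Pi.single i 1) (h : m ≤ n) :
    (pathOfLabelling hE).seg m n h = generator R i (E i m) := by
  have : route (n - m) = [i] := List.perm_singleton.1 (perm_of_displacement_eq (by simp [hmn]))
  simp [pathOfLabelling, this]

theorem InfinitePath.exists_edge (x : InfinitePath (assocDegree R k)) (i : Fin k) (n : Fin k → ℕ) :
    ∃ s, x.seg n (n + Pi.single i 1) le_self_add = generator R i s :=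
  exists_eq_generator (by rw [x.degree_seg, add_tsub_cancel_left])

/-- The labelling read off an infinite path. -/
noncomputable def InfinitePath.labels (x : InfinitePath (assocDegree R k)) (i : Fin k)
    (n : Fin k → ℕ) : Fin N :=
  (x.exists_edge i n).choose

theorem InfinitePath.seg_edge (x : InfinitePath (assocDegree R k)) (i : Fin k) (n : Fin k → ℕ) :
    x.seg n (n + Pi.single i 1) le_self_add = generator R i (x.labels i n) :=
  (x.exists_edge i n).choose_spec

theorem InfinitePath.seg_eq_routeProd (x : InfinitePath (assocDegree R k)) (w : List (Fin k))
    (m n : Fin k → ℕ) (hn : n = m + displacement w) (h : m ≤ n) :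
    x.seg m n h = routeProd R x.labels w m := by
  induction w generalizing m with
  | nil =>
    obtain rfl : n = m := by simpa using hn
    rw [x.seg_self, routeProd_nil]
  | cons i w ih =>
    have hn' : n = m + Pi.single i 1 + displacement w := by
      rw [hn, displacement_cons, add_assoc]
    have h' : m + Pi.single i 1 ≤ n := hn' ▸ le_self_add
    rw [routeProd_cons, ← x.seg_edge, ← ih _ hn' h', x.seg_mul]

theorem InfinitePath.isLabelling_labels (hR : Function.Bijective R)
    (x : InfinitePath (assocDegree R k)) :
    IsLabelling (Equiv.ofBijective R hR) Set.univ x.labels := by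
  refine isLabelling_of_lt fun i _ j _ hij n => ?_
  refine colourSwap_of_generator_mul hR hij ?_
  have hle : n ≤ n + Pi.single i 1 + Pi.single j 1 := le_self_add.trans le_self_add
  have h₁ := x.seg_eq_routeProd [i, j] n _ (by simp [add_assoc]) hle
  have h₂ := x.seg_eq_routeProd [j, i] n _ (by
    simp [add_assoc, add_comm (Pi.single i 1 : Fin k → ℕ)]) hle
  simpa using h₁.symm.trans h₂

/-- A path is the product of its edges along any route, and a generator determines its label; the
same `m` and `n` therefore work on both sides. -/
theorem isPeriodicGraph_iff (hR : Function.Bijective R) :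
    IsPeriodicGraph (assocDegree R k) ↔
      HasPeriodicLabellings (Equiv.ofBijective R hR) (Fin k) := by
  constructor
  · rintro ⟨m, n, hmn, h⟩
    refine ⟨m, n, hmn, fun E hE i l => generator_injective hR i ?_⟩
    have hseg := congrArg (fun y => y.seg l (l + Pi.single i 1) le_self_add)
      (h (pathOfLabelling hE))
    dsimp only [InfinitePath.shift] at hseg
    rwa [pathOfLabelling_seg_edge hE i (add_right_comm _ _ _),
      pathOfLabelling_seg_edge hE i (add_right_comm _ _ _)] at hseg
  · rintro ⟨m, n, hmn, h⟩
    refine ⟨m, n, hmn, fun x => ?_⟩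
    have hx := h _ (x.isLabelling_labels hR)
    have hseg : ∀ (p a b : Fin k → ℕ) (hab : a ≤ b), (x.shift p).seg a b hab =
        routeProd R x.labels (route (b - a)) (a + p) := by
      intro p a b hab
      refine x.seg_eq_routeProd _ _ _ ?_ _
      rw [displacement_route, add_right_comm, add_tsub_cancel_of_le hab]
    ext a b hab
    rw [hseg, hseg, routeProd, routeProd, labelsAlong_congr _ (a + m) (a + n) fun i l => ?_]
    rw [add_right_comm, hx, add_right_comm]

end Paths

theorem IsYBESolution.isBraided {X : Type*} {R : X × X → X × X} (hR : IsYBESolution R) :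
    IsBraided (Equiv.ofBijective R hR.1) :=
  Equiv.ext fun p => congrFun hR.2 p

theorem proposition4p7 (N : ℕ) (hN : 1 ≤ N) (R : Fin N × Fin N → Fin N × Fin N)
    (hR : IsYBESolution R) (k : ℕ) (hk : 3 ≤ k) :
    IsPeriodicGraph (assocDegree R 2) ↔ IsPeriodicGraph (assocDegree R k) := by
  have : Nonempty (Fin N) := ⟨⟨0, hN⟩⟩
  rw [isPeriodicGraph_iff hR.1, isPeriodicGraph_iff hR.1]
  exact hasPeriodicLabellings_iff_two hR.isBraided (by omega)
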